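/- For $s\in\mathbb R$ let $D^s$ be the completion of the complex span of the functions $\sin(kx)$, $k=1,2,\dots$, on $(0,\pi)$ for the norm $\big\|\sum_k c_k\sin(kx)\big\|_s^2=\sum_k k^{2s}|c_k|^2$. Let $s\le r$ be real numbers. For $y_0\in D^r$, $y_1\in D^{r-2}$ consider the solution $y\in C(\mathbb R,D^r)\cap C^1(\mathbb R,D^{r-2})\cap C^2(\mathbb R,D^{r-4})$ of the hinged beam problem $$y''+y_{xxxx}=0\ \text{in }\mathbb R\times(0,\pi),\qquad y=y_{xx}=0\ \text{on }\mathbb R\times\{0,\pi\},\qquad y(0)=y_0,\quad y'(0)=y_1 .$$ A pair $(t_0,t_1)\in\mathbb R^2$ is called strategic if there is a constant $c>0$ such that $$\|y_0\|_s+\|y_1\|_{s-2}\le c\,\big(\|y(t_0)\|_r+\|y(t_1)\|_r\big)\qquad\text{for all }(y_0,y_1)\in D^r\times D^{r-2}.$$ Writing $\|x\|$ for the distance from a real number $x$ to the nearest integer, the pair $(t_0,t_1)$ is strategic if and only if there is a constant $c>0$ such that $\big\|k^2(t_0-t_1)/\pi\big\|\ge c\,k^{-(r-s)}$ for all $k=1,2,\dots$.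 Moreover: (a) If $r-s=2$, there is a set of strategic pairs that is infinite, has zero Lebesgue measure and has full Hausdorff dimension (that is, dimension $2$) in $\mathbb R^2$. (b) If $r-s>2$, almost all pairs $(t_0,t_1)\in\mathbb R^2$ (for Lebesgue measure) are strategic. -/

import Mathlib

open MeasureTheory

noncomputable section

namespace HingedBeam

/-! ### The spaces of sine series

The function with sine coefficients `c k` is `∑ k, c k * sin (k x)`, with `k = 1, 2, …`. -/

/-- The space `ℂ` of the `k`-th sine coefficient, to be normed by `a ↦ k ^ s * |a|`. -/
def Mode (_s : ℝ) (_k : ℕ+) : Type := ℂ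

instance (s : ℝ) (k : ℕ+) : AddCommGroup (Mode s k) := inferInstanceAs (AddCommGroup ℂ)
instance (s : ℝ) (k : ℕ+) : Module ℂ (Mode s k) := inferInstanceAs (Module ℂ ℂ)
instance (s : ℝ) (k : ℕ+) : FiniteDimensional ℂ (Mode s k) :=
  inferInstanceAs (FiniteDimensional ℂ ℂ)

/-- The identity from `ℂ` to `Mode s k`. -/
def Mode.of (s : ℝ) (k : ℕ+) : ℂ ≃ₗ[ℂ] Mode s k := LinearEquiv.refl ℂ ℂ

/-- Multiplication by the weight `k ^ s`. -/
def Mode.weight (s : ℝ) (k : ℕ+) : Mode s k →ₗ[ℂ] ℂ :=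
  (((k : ℝ) ^ s : ℝ) : ℂ) • (Mode.of s k).symm.toLinearMap

theorem weight_pos (s : ℝ) (k : ℕ+) : 0 < (k : ℝ) ^ s :=
  Real.rpow_pos_of_pos (by exact_mod_cast k.pos) s

theorem Mode.weight_injective (s : ℝ) (k : ℕ+) : Function.Injective (Mode.weight s k) := by
  intro a b h
  exact (Mode.of s k).symm.injective
    (mul_left_cancel₀ (Complex.ofReal_ne_zero.mpr (weight_pos s k).ne') h)

instance (s : ℝ) (k : ℕ+) : NormedAddCommGroup (Mode s k) :=
  NormedAddCommGroup.induced (Mode s k) ℂ (Mode.weight s k) (Mode.weight_injective s k)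
instance (s : ℝ) (k : ℕ+) : NormedSpace ℂ (Mode s k) :=
  NormedSpace.induced ℂ (Mode s k) ℂ (Mode.weight s k)
instance (s : ℝ) (k : ℕ+) : CompleteSpace (Mode s k) := FiniteDimensional.complete ℂ _

theorem Mode.norm_eq (s : ℝ) (k : ℕ+) (a : ℂ) :
    ‖Mode.of s k a‖ = (k : ℝ) ^ s * ‖a‖ := by
  change ‖(((k : ℝ) ^ s : ℝ) : ℂ) * a‖ = _
  rw [norm_mul, Complex.norm_real, Real.norm_of_nonneg (weight_pos s k).le]

/-- The space `D^s`: the completion of the span of the functions `sin (k x)`, `k = 1, 2, …`,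
for the norm `‖∑ c k * sin (k x)‖_s ^ 2 = ∑ k ^ (2 s) * |c k| ^ 2`. The completion is realized as
the space of all sequences `c` of sine coefficients for which this quantity is finite
(see `norm_sq_eq`, `toD_coeff`, `denseRange_toD` and the instance of `CompleteSpace`). -/
def D (s : ℝ) : Type := lp (Mode s) 2

instance (s : ℝ) : NormedAddCommGroup (D s) := inferInstanceAs (NormedAddCommGroup (lp (Mode s) 2))
instance (s : ℝ) : NormedSpace ℂ (D s) := inferInstanceAs (NormedSpace ℂ (lp (Mode s) 2))
instance (s : ℝ) : CompleteSpace (D s) := inferInstanceAs (CompleteSpace (lp (Mode s) 2))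

/-- The sine coefficients of an element of `D^s`. -/
def coeff (s : ℝ) : D s →ₗ[ℂ] (ℕ+ → ℂ) where
  toFun f := fun k => (Mode.of s k).symm ((show lp (Mode s) 2 from f) k)
  map_add' _ _ := rfl
  map_smul' _ _ := rfl

theorem coeff_injective (s : ℝ) : Function.Injective (coeff s) := by
  intro f g h
  exact lp.ext (E := Mode s) (p := 2) h

theorem memℓp_iff (s : ℝ) (c : ℕ+ → ℂ) :
    Memℓp (fun k => Mode.of s k (c k)) 2 ↔ Summable fun k : ℕ+ => (k : ℝ) ^ (2 * s) * ‖c k‖ ^ 2 := by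
  rw [memℓp_gen_iff (by norm_num)]
  refine summable_congr fun k => ?_
  rw [Mode.norm_eq, ENNReal.toReal_ofNat, Real.rpow_two, mul_pow, ← Real.rpow_mul_natCast (by positivity)]
  congr 2
  push_cast
  ring

/-- The element of `D^s` with the given sine coefficients. -/
def ofCoeff (s : ℝ) (c : ℕ+ → ℂ)
    (hc : Summable fun k : ℕ+ => (k : ℝ) ^ (2 * s) * ‖c k‖ ^ 2) : D s :=
  (⟨fun k => Mode.of s k (c k), (memℓp_iff s c).mpr hc⟩ : lp (Mode s) 2)

theorem coeff_ofCoeff (s : ℝ) (c : ℕ+ → ℂ)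
    (hc : Summable fun k : ℕ+ => (k : ℝ) ^ (2 * s) * ‖c k‖ ^ 2) :
    coeff s (ofCoeff s c hc) = c := rfl

theorem summable_coeff (s : ℝ) (f : D s) :
    Summable fun k : ℕ+ => (k : ℝ) ^ (2 * s) * ‖coeff s f k‖ ^ 2 :=
  (memℓp_iff s (coeff s f)).mp (lp.memℓp (show lp (Mode s) 2 from f))

theorem norm_sq_eq (s : ℝ) (f : D s) :
    ‖f‖ ^ 2 = ∑' k : ℕ+, (k : ℝ) ^ (2 * s) * ‖coeff s f k‖ ^ 2 := by
  have h := lp.norm_rpow_eq_tsum (p := 2) (by norm_num) (show lp (Mode s) 2 from f)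
  rw [ENNReal.toReal_ofNat, Real.rpow_two] at h
  refine h.trans (tsum_congr fun k => ?_)
  change ‖Mode.of s k (coeff s f k)‖ ^ (2 : ℝ) = _
  rw [Mode.norm_eq, Real.rpow_two, mul_pow, ← Real.rpow_mul_natCast (by positivity)]
  congr 2
  push_cast
  ring

/-- The operator that multiplies the `k`-th sine coefficient by `m k`. -/
def multiplier (s s' : ℝ) (m : ℕ+ → ℂ) (hm : ∀ k : ℕ+, ‖m k‖ * (k : ℝ) ^ s' ≤ (k : ℝ) ^ s) :
    D s →L[ℂ] D s' :=
  have hle : ∀ (f : D s) (k : ℕ+), (k : ℝ) ^ (2 * s') * ‖m k * coeff s f k‖ ^ 2 ≤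
      (k : ℝ) ^ (2 * s) * ‖coeff s f k‖ ^ 2 := by
    intro f k
    have h2 : ∀ t : ℝ, (k : ℝ) ^ (2 * t) = ((k : ℝ) ^ t) ^ 2 := by
      intro t
      rw [← Real.rpow_mul_natCast (by positivity)]
      congr 1
      push_cast
      ring
    have h := pow_le_pow_left₀ (mul_nonneg (norm_nonneg _) (weight_pos s' k).le) (hm k) 2
    rw [h2, h2, norm_mul]
    calc _ = (‖m k‖ * (k : ℝ) ^ s') ^ 2 * ‖coeff s f k‖ ^ 2 := by ring
      _ ≤ _ := by gcongr
  have hsum : ∀ f : D s, Summable fun k : ℕ+ => (k : ℝ) ^ (2 * s') * ‖m k * coeff s f k‖ ^ 2 :=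
    fun f => (summable_coeff s f).of_nonneg_of_le (fun k => by positivity) (hle f)
  LinearMap.mkContinuous
    { toFun := fun f => ofCoeff s' (fun k => m k * coeff s f k) (hsum f)
      map_add' := fun f g => coeff_injective s' <| by
        funext k
        exact mul_add (m k) (coeff s f k) (coeff s g k)
      map_smul' := fun a f => coeff_injective s' <| by
        funext k
        exact mul_left_comm (m k) a (coeff s f k) } 1 <| by
    intro f
    rw [one_mul]
    refine (sq_le_sq₀ (norm_nonneg _) (norm_nonneg _)).mp ?_
    rw [norm_sq_eq, norm_sq_eq]
    exact (hsum f).tsum_le_tsum (hle f) (summable_coeff s f)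

theorem coeff_multiplier (s s' : ℝ) (m : ℕ+ → ℂ)
    (hm : ∀ k : ℕ+, ‖m k‖ * (k : ℝ) ^ s' ≤ (k : ℝ) ^ s) (f : D s) (k : ℕ+) :
    coeff s' (multiplier s s' m hm f) k = m k * coeff s f k := rfl

/-- The inclusion of `D^s` in `D^s'` for `s' ≤ s`. -/
def incl {s s' : ℝ} (h : s' ≤ s) : D s →L[ℂ] D s' :=
  multiplier s s' (fun _ => 1) fun k => by
    rw [norm_one, one_mul]
    exact Real.rpow_le_rpow_of_exponent_le (by exact_mod_cast one_le (a := k)) h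

/-- The operator `∂_x^4` from `D^s` to `D^(s-4)`: `sin (k x)` is mapped to `k ^ 4 * sin (k x)`
(see `fourthDeriv_toD`). -/
def fourthDeriv (s : ℝ) : D s →L[ℂ] D (s - 4) :=
  multiplier s (s - 4) (fun k => (k : ℂ) ^ 4) fun k => by
    have hk : (0 : ℝ) < k := by exact_mod_cast k.pos
    rw [norm_pow, Complex.norm_natCast, ← Real.rpow_natCast, ← Real.rpow_add hk]
    exact le_of_eq (by congr 1; push_cast; ring)

theorem coeff_incl {s s' : ℝ} (h : s' ≤ s) (f : D s) : coeff s' (incl h f) = coeff s f := by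
  funext k
  exact (coeff_multiplier _ _ _ _ _ _).trans (one_mul _)

theorem coeff_fourthDeriv (s : ℝ) (f : D s) (k : ℕ+) :
    coeff (s - 4) (fourthDeriv s f) k = (k : ℂ) ^ 4 * coeff s f k := rfl

/-! ### `D^s` is the completion of the span of the sines -/

/-- The function `sin (k x)`. -/
def sine (k : ℕ+) : ℝ → ℂ := fun x => (Real.sin (k * x) : ℂ)

theorem linearIndependent_sine : LinearIndependent ℂ sine := by
  let T : Module.End ℂ (ℝ → ℂ) :=
    { toFun := fun f x => f (x + 1) + f (x - 1)
      map_add' := fun f g => by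
        funext x
        simp only [Pi.add_apply]
        ring
      map_smul' := fun a f => by
        funext x
        simp only [Pi.smul_apply, smul_eq_mul, RingHom.id_apply]
        ring }
  refine Module.End.eigenvectors_linearIndependent' T
    (fun k : ℕ+ => ((2 * Real.cos k : ℝ) : ℂ)) ?_ sine ?_
  · intro j k h
    have h1 : Real.cos j = Real.cos k := by
      have := Complex.ofReal_injective h
      linarith
    obtain ⟨n, hn⟩ := Real.cos_eq_cos_iff.mp h1
    have hj : (0 : ℝ) < j := by exact_mod_cast j.pos
    have hk : (0 : ℝ) < k := by exact_mod_cast k.pos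
    have key : ∀ z : ℤ, 2 * (n : ℝ) * Real.pi = z → n = 0 := by
      intro z hz
      by_contra hne
      have hne' : (n : ℝ) ≠ 0 := by exact_mod_cast hne
      refine irrational_pi ⟨(z : ℚ) / (2 * n), ?_⟩
      push_cast
      rw [← hz]
      field_simp
    rcases hn with hn | hn
    · have h0 := key ((k : ℕ) - (j : ℕ)) (by push_cast; linarith)
      rw [h0] at hn
      have : (k : ℝ) = j := by simpa only [Int.cast_zero, mul_zero, zero_mul, zero_add] using hn
      exact PNat.coe_injective (by exact_mod_cast this.symm)
    · have h0 := key ((k : ℕ) + (j : ℕ)) (by push_cast; linarith)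
      rw [h0] at hn
      have : (k : ℝ) = -j := by simpa only [Int.cast_zero, mul_zero, zero_mul, zero_sub] using hn
      linarith
  · intro k
    refine ⟨Module.End.mem_eigenspace_iff.mpr ?_, ?_⟩
    · funext x
      change ((Real.sin (k * (x + 1)) : ℝ) : ℂ) + ((Real.sin (k * (x - 1)) : ℝ) : ℂ)
        = ((2 * Real.cos k : ℝ) : ℂ) * ((Real.sin (k * x) : ℝ) : ℂ)
      rw [mul_add, mul_sub, mul_one, Real.sin_add, Real.sin_sub]
      push_cast
      ring
    · intro h
      have hk : (k : ℝ) ≠ 0 := by exact_mod_cast k.ne_zero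
      have := congrFun h (Real.pi / 2 / k)
      simp [sine, mul_div_cancel₀ _ hk] at this

/-- The map from the span of the sines to `D^s`. -/
def toD (s : ℝ) : Submodule.span ℂ (Set.range sine) →ₗ[ℂ] D s where
  toFun f := ofCoeff s ((Module.Basis.span linearIndependent_sine).repr f) <|
    summable_of_ne_finset_zero
      (s := ((Module.Basis.span linearIndependent_sine).repr f).support) fun k hk => by
        rw [Finsupp.notMem_support_iff.mp hk, norm_zero, zero_pow two_ne_zero, mul_zero]
  map_add' f g := coeff_injective s <| by
    rw [(coeff s).map_add]
    simp only [coeff_ofCoeff, map_add, Finsupp.coe_add]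
  map_smul' a f := coeff_injective s <| by
    rw [(coeff s).map_smul]
    simp only [coeff_ofCoeff, map_smul, Finsupp.coe_smul, RingHom.id_apply]

/-- `toD` maps `∑ k, c k * sin (k x)` to the sequence `c`. -/
theorem toD_coeff (s : ℝ) (c : ℕ+ →₀ ℂ) (f : Submodule.span ℂ (Set.range sine))
    (hf : (f : ℝ → ℂ) = fun x => c.sum fun k a => a * (Real.sin (k * x) : ℂ)) :
    coeff s (toD s f) = c := by
  have h : f = Finsupp.linearCombination ℂ (Module.Basis.span linearIndependent_sine) c := by
    apply Subtype.ext
    rw [hf, Finsupp.linearCombination_apply, Finsupp.sum, AddSubmonoidClass.coe_finsetSum]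
    funext x
    simp only [Finset.sum_apply, Finsupp.sum]
    refine Finset.sum_congr rfl fun k _ => ?_
    rw [Submodule.coe_smul, Module.Basis.span_apply]
    rfl
  change ((Module.Basis.span linearIndependent_sine).repr f : ℕ+ → ℂ) = c
  rw [h, Module.Basis.repr_linearCombination]

theorem denseRange_toD (s : ℝ) : DenseRange (toD s) := by
  intro f
  have h := lp.hasSum_single (E := Mode s) (p := 2) (by norm_num) (show lp (Mode s) 2 from f)
  refine mem_closure_of_tendsto h (Filter.Eventually.of_forall fun t => ?_)
  refine (LinearMap.range (toD s)).sum_mem fun k _ => ?_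
  refine ⟨coeff s f k • Module.Basis.span linearIndependent_sine k, coeff_injective s ?_⟩
  change ((Module.Basis.span linearIndependent_sine).repr _ : ℕ+ → ℂ) = _
  rw [map_smul, Module.Basis.repr_self]
  funext j
  change _ = (Mode.of s j).symm ((lp.single (E := Mode s) 2 k (Mode.of s k (coeff s f k))) j)
  by_cases hjk : j = k
  · subst hjk
    rw [lp.single_apply_self, LinearEquiv.symm_apply_apply]
    simp
  · rw [lp.single_apply_ne _ _ _ hjk, map_zero]
    simp [hjk]

theorem iteratedDeriv_sine (k : ℕ+) : iteratedDeriv 4 (sine k) = (k : ℂ) ^ 4 • sine k := by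
  have h1 : ∀ x : ℝ, HasDerivAt (fun x : ℝ => (Real.sin (k * x) : ℂ))
      ((k : ℂ) * (Real.cos (k * x) : ℂ)) x := fun x => by
    have := ((hasDerivAt_id x).const_mul (k : ℝ)).sin.ofReal_comp
    refine this.congr_deriv ?_
    push_cast [id]
    ring
  have h2 : ∀ x : ℝ, HasDerivAt (fun x : ℝ => (Real.cos (k * x) : ℂ))
      (-((k : ℂ) * (Real.sin (k * x) : ℂ))) x := fun x => by
    have := ((hasDerivAt_id x).const_mul (k : ℝ)).cos.ofReal_comp
    refine this.congr_deriv ?_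
    push_cast [id]
    ring
  have e1 : deriv (sine k) = fun x : ℝ => (k : ℂ) * (Real.cos (k * x) : ℂ) :=
    funext fun x => (h1 x).deriv
  have e2 : deriv (fun x : ℝ => (k : ℂ) * (Real.cos (k * x) : ℂ)) =
      fun x : ℝ => (k : ℂ) * (-((k : ℂ) * (Real.sin (k * x) : ℂ))) :=
    funext fun x => ((h2 x).const_mul (k : ℂ)).deriv
  have e3 : deriv (fun x : ℝ => (k : ℂ) * (-((k : ℂ) * (Real.sin (k * x) : ℂ)))) =
      fun x : ℝ => (k : ℂ) * (-((k : ℂ) * ((k : ℂ) * (Real.cos (k * x) : ℂ)))) :=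
    funext fun x => ((((h1 x).const_mul (k : ℂ)).neg).const_mul (k : ℂ)).deriv
  have e4 : deriv (fun x : ℝ => (k : ℂ) * (-((k : ℂ) * ((k : ℂ) * (Real.cos (k * x) : ℂ))))) =
      fun x : ℝ => (k : ℂ) * (-((k : ℂ) * ((k : ℂ) * (-((k : ℂ) * (Real.sin (k * x) : ℂ)))))) :=
    funext fun x =>
      (((((h2 x).const_mul (k : ℂ)).const_mul (k : ℂ)).neg).const_mul (k : ℂ)).deriv
  rw [iteratedDeriv_succ, iteratedDeriv_succ, iteratedDeriv_succ, iteratedDeriv_one,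
    e1, e2, e3, e4]
  funext x
  change _ = (k : ℂ) ^ 4 * (Real.sin (k * x) : ℂ)
  ring

/-- On the span of the sines, `fourthDeriv` is the fourth derivative. -/
theorem fourthDeriv_toD (s : ℝ) (f g : Submodule.span ℂ (Set.range sine))
    (h : (g : ℝ → ℂ) = iteratedDeriv 4 (f : ℝ → ℂ)) :
    fourthDeriv s (toD s f) = toD (s - 4) g := by
  let b := Module.Basis.span linearIndependent_sine
  obtain ⟨L, hLb⟩ : ∃ L : Submodule.span ℂ (Set.range sine) →ₗ[ℂ]
      Submodule.span ℂ (Set.range sine), ∀ k, L (b k) = (k : ℂ) ^ 4 • b k :=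
    ⟨b.constr ℂ fun k => (k : ℂ) ^ 4 • b k, b.constr_basis ℂ _⟩
  have hb : ∀ k, b k = ⟨sine k, Submodule.subset_span ⟨k, rfl⟩⟩ := fun k =>
    Module.Basis.span_apply linearIndependent_sine k
  have hL : ∀ (f : ℝ → ℂ) (hf : f ∈ Submodule.span ℂ (Set.range sine)),
      ContDiff ℝ ((4 : ℕ) : WithTop ℕ∞) f ∧ iteratedDeriv 4 f = (L ⟨f, hf⟩ : ℝ → ℂ) := by
    intro f hf
    induction hf using Submodule.span_induction with
    | mem f hf =>
      obtain ⟨k, rfl⟩ := hf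
      refine ⟨?_, ?_⟩
      · exact Complex.ofRealCLM.contDiff.comp
          (Real.contDiff_sin.comp (contDiff_const.mul contDiff_id))
      · have h1 : L (b k) = (k : ℂ) ^ 4 • b k := hLb k
        rw [hb] at h1
        rw [h1, iteratedDeriv_sine]
        rfl
    | zero =>
      refine ⟨contDiff_const, ?_⟩
      have h0 : L ⟨0, zero_mem _⟩ = 0 := L.map_zero
      rw [h0]
      funext x
      exact iteratedDeriv_const_zero
    | add f g hf hg ihf ihg =>
      refine ⟨ihf.1.add ihg.1, ?_⟩
      have h0 : L ⟨f + g, add_mem hf hg⟩ = L ⟨f, hf⟩ + L ⟨g, hg⟩ :=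
        L.map_add ⟨f, hf⟩ ⟨g, hg⟩
      rw [h0, Submodule.coe_add, ← ihf.2, ← ihg.2]
      funext x
      exact iteratedDeriv_add (n := 4) ihf.1.contDiffAt ihg.1.contDiffAt
    | smul a f hf ihf =>
      refine ⟨contDiff_const.smul ihf.1, ?_⟩
      have h0 : L ⟨a • f, Submodule.smul_mem _ a hf⟩ = a • L ⟨f, hf⟩ :=
        L.map_smul a ⟨f, hf⟩
      rw [h0, Submodule.coe_smul, ← ihf.2]
      funext x
      exact iteratedDeriv_const_smul_field a f
  have hg : g = L f := Subtype.ext (h.trans (hL f f.2).2)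
  have hlin : (fourthDeriv s : D s →ₗ[ℂ] D (s - 4)) ∘ₗ toD s = toD (s - 4) ∘ₗ L := by
    refine b.ext fun k => coeff_injective _ ?_
    funext j
    rw [LinearMap.comp_apply, LinearMap.comp_apply, hLb, map_smul, map_smul]
    change (j : ℂ) ^ 4 * (b.repr (b k)) j = (k : ℂ) ^ 4 * (b.repr (b k)) j
    rw [b.repr_self]
    by_cases hjk : j = k
    · rw [hjk]
    · simp [hjk]
  rw [hg]
  exact LinearMap.congr_fun hlin f

/-! ### Solutions of the hinged beam equation -/

/-- `y` is the solution in `C(ℝ, D^s) ∩ C¹(ℝ, D^(s-2)) ∩ C²(ℝ, D^(s-4))` of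
`y'' + y_xxxx = 0` on `ℝ × (0, π)`, `y = y_xx = 0` on `ℝ × {0, π}`, `y(0) = y₀`, `y'(0) = y₁`.
As usual, the boundary conditions are expressed by the membership in the spaces `D^s`. -/
structure IsSolution (s : ℝ) (y₀ : D s) (y₁ : D (s - 2)) (y : ℝ → D s) : Prop where
  continuous : Continuous y
  contDiff_one : ContDiff ℝ 1 fun t => incl (show s - 2 ≤ s by linarith) (y t)
  contDiff_two : ContDiff ℝ 2 fun t => incl (show s - 4 ≤ s by linarith) (y t)
  equation : ∀ t, iteratedDeriv 2 (fun t => incl (show s - 4 ≤ s by linarith) (y t)) t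
    + fourthDeriv s (y t) = 0
  initial_position : y 0 = y₀
  initial_velocity : deriv (fun t => incl (show s - 2 ≤ s by linarith) (y t)) 0 = y₁

/-- The pair `(t₀, t₁)` is strategic: the observability inequality
`‖y₀‖_s + ‖y₁‖_(s-2) ≤ c (‖y(t₀)‖_r + ‖y(t₁)‖_r)` holds with a constant `c > 0` that does not depend
on the initial data `(y₀, y₁)` in `D^r × D^(r-2)`. -/
def IsStrategicPair (r s : ℝ) (hsr : s ≤ r) (p : ℝ × ℝ) : Prop :=
  ∃ c : ℝ, 0 < c ∧ ∀ (y₀ : D r) (y₁ : D (r - 2)) (y : ℝ → D r), IsSolution r y₀ y₁ y →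
    ‖incl hsr y₀‖ + ‖incl (sub_le_sub_right hsr 2) y₁‖ ≤ c * (‖y p.1‖ + ‖y p.2‖)

end HingedBeam

end

/-! ### Metric Diophantine approximation along the squares -/

section DiophantineNullSets

open Filter Topology

open scoped ENNReal NNReal

/-! The `k`-th sine coefficient of a solution is an oscillation `A cos (k² t) + B sin (k² t)`, with
`A` and `k² B` the coefficients of the initial data (`IsSolution.coeff_eq`). Its values at `t₀` and
`t₁` determine `A` and `B` through a linear system with determinant `± sin (k² (t₀ - t₁))`, whose
size is comparable to the distance of `k² (t₀ - t₁) / π` to the nearest integer. Passing from the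
norm of index `r` to that of index `s` allows a loss of `k ^ (r - s)`, so a lower bound of order `k
^ (-(r - s))` for the determinant suffices by Cramer's rule. It is necessary because single-mode
solutions that vanish at `t₀` lose exactly the determinant.

By Borel–Cantelli, almost every `x` satisfies the condition for any exponent `τ > 1`
(`ae_sqBadlyApproximable`). Pulling back along `(t₀ - t₁) / π` gives (b). For (a) the same conull
set `G` is used, and a null subset of the strategic pairs is cut out by restricting `t₀` to a null
set `N` of dimension 1: the union over `n` of the numbers whose base `n + 1` digits avoid `n`. A
Hölder base change on each piece shows that `N × (G ∩ [0, 1])` still has dimension 2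
(`two_mul_le_dimH_prod`), and a shear carries this product into the set of pairs. -/

theorem abs_sub_round_eq_norm (x : ℝ) : |x - round x| = ‖(x : UnitAddCircle)‖ :=
  UnitAddCircle.norm_eq.symm

/-- Almost every point of the circle satisfies the Borel–Cantelli lower bound along the squares. -/
theorem ae_eventually_le_norm_sq_nsmul {τ : ℝ} (hτ : 1 < τ) :
    ∀ᵐ x : UnitAddCircle, ∀ᶠ k : ℕ in atTop, (k : ℝ) ^ (-τ) ≤ ‖(k ^ 2) • x‖ := by
  have hsum : Summable fun k : ℕ => 2 * (k : ℝ) ^ (-τ) :=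
    (Real.summable_nat_rpow.mpr (by linarith)).mul_left 2
  have hmeas : ∀ k : ℕ, 1 ≤ k → volume {x : UnitAddCircle | ‖(k ^ 2) • x‖ ≤ (k : ℝ) ^ (-τ)} ≤
      ENNReal.ofReal (2 * (k : ℝ) ^ (-τ)) := by
    intro k hk
    -- Multiplication by `k²` preserves Haar measure, so the exceptional set has the measure of a
    -- ball.
    have hmp := Measure.measurePreserving_zsmul (volume : Measure UnitAddCircle) (n := ((k ^ 2 : ℕ) : ℤ))
      (by positivity)
    simp only [natCast_zsmul] at hmp
    have hpre : {x : UnitAddCircle | ‖(k ^ 2) • x‖ ≤ (k : ℝ) ^ (-τ)} =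
        (fun x => (k ^ 2) • x) ⁻¹' Metric.closedBall (0 : UnitAddCircle) ((k : ℝ) ^ (-τ)) := by
      ext x
      simp
    rw [hpre, hmp.measure_preimage measurableSet_closedBall.nullMeasurableSet,
      AddCircle.volume_closedBall]
    exact ENNReal.ofReal_le_ofReal (min_le_right _ _)
  -- `k = 0` is excluded: there the exceptional set is the whole circle, while the bounding term is
  -- `0`.
  have hfin : ∑' k : ℕ, volume {x : UnitAddCircle | 1 ≤ k ∧ ‖(k ^ 2) • x‖ ≤ (k : ℝ) ^ (-τ)} ≠ ∞ := by
    refine ne_top_of_le_ne_top hsum.tsum_ofReal_ne_top (ENNReal.tsum_le_tsum fun k => ?_)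
    by_cases hk : 1 ≤ k
    · exact (measure_mono fun x hx => hx.2).trans (hmeas k hk)
    · simp [hk]
  filter_upwards [ae_eventually_notMem hfin] with x hx
  filter_upwards [hx, eventually_ge_atTop 1] with k hk hk1
  by_contra! h
  exact hk ⟨hk1, h.le⟩

/-- `‖k² x‖ ≥ c k^(-τ)` for all `k ≥ 1` with some `c > 0`, where `‖·‖` is the distance to the
nearest integer. -/
def SqBadlyApproximable (τ x : ℝ) : Prop :=
  ∃ c : ℝ, 0 < c ∧ ∀ k : ℕ, 1 ≤ k →
    c * (k : ℝ) ^ (-τ) ≤ |(k : ℝ) ^ 2 * x - round ((k : ℝ) ^ 2 * x)|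

theorem ae_of_ae_unitAddCircle {p : UnitAddCircle → Prop} (h : ∀ᵐ x, p x) :
    ∀ᵐ x : ℝ, p (x : UnitAddCircle) := by
  have h1 : ∀ n : ℤ, ∀ᵐ x : ℝ ∂volume.restrict (Set.Ioc (n : ℝ) (n + 1)), p (x : UnitAddCircle) :=
    fun n => (UnitAddCircle.measurePreserving_mk (n : ℝ)).quasiMeasurePreserving.ae h
  have h2 := (ae_restrict_iUnion_iff (μ := volume) (fun n : ℤ => Set.Ioc (n : ℝ) (n + 1))
    fun x => p (x : UnitAddCircle)).mpr h1
  rwa [iUnion_Ioc_intCast, Measure.restrict_univ] at h2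

/-- Finitely many exceptional indices only shrink the constant, since `v` is positive there. -/
theorem exists_pos_mul_le_of_eventually_le {u v : ℕ → ℝ} (hu : ∀ k, 1 ≤ k → 0 < u k)
    (hv : ∀ k, 1 ≤ k → 0 < v k) (h : ∀ᶠ k in atTop, u k ≤ v k) :
    ∃ c : ℝ, 0 < c ∧ ∀ k, 1 ≤ k → c * u k ≤ v k := by
  obtain ⟨K, hK⟩ := eventually_atTop.mp h
  have key : ∀ K, ∃ c : ℝ, 0 < c ∧ c ≤ 1 ∧ ∀ k, 1 ≤ k → k < K → c * u k ≤ v k := by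
    intro K
    induction K with
    | zero => exact ⟨1, one_pos, le_rfl, fun k _ hk => absurd hk (Nat.not_lt_zero k)⟩
    | succ K ih =>
      obtain ⟨c, hc, hc1, hcK⟩ := ih
      rcases Nat.eq_zero_or_pos K with rfl | hK
      · exact ⟨1, one_pos, le_rfl, fun k h1 hk => by omega⟩
      · refine ⟨min c (v K / u K), lt_min hc (div_pos (hv K hK) (hu K hK)),
          (min_le_left _ _).trans hc1, fun k h1 hk => ?_⟩
        rcases Nat.lt_succ_iff_lt_or_eq.mp hk with hk | rfl
        · exact (mul_le_mul_of_nonneg_right (min_le_left _ _) (hu k h1).le).trans (hcK k h1 hk)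
        · exact (mul_le_mul_of_nonneg_right (min_le_right _ _) (hu k h1).le).trans
            (div_mul_cancel₀ _ (hu k h1).ne').le
  obtain ⟨c, hc, hc1, hcK⟩ := key K
  refine ⟨c, hc, fun k hk => ?_⟩
  rcases lt_or_ge k K with h | h
  · exact hcK k hk h
  · exact (mul_le_of_le_one_left (hu k hk).le hc1).trans (hK k h)

/-- Borel–Cantelli controls large `k`; irrationality of `x` makes the remaining distances positive.
-/
theorem ae_sqBadlyApproximable {τ : ℝ} (hτ : 1 < τ) : ∀ᵐ x : ℝ, SqBadlyApproximable τ x := by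
  have hirr : ∀ᵐ x : ℝ, x ∉ Set.range ((↑) : ℚ → ℝ) :=
    (Set.countable_range _).ae_notMem _
  filter_upwards [hirr, ae_of_ae_unitAddCircle (ae_eventually_le_norm_sq_nsmul hτ)] with x hx h
  refine exists_pos_mul_le_of_eventually_le (fun k hk => ?_) (fun k hk => ?_) ?_
  · exact Real.rpow_pos_of_pos (by exact_mod_cast hk) _
  · refine abs_pos.mpr fun h0 => hx ⟨(round ((k : ℝ) ^ 2 * x) : ℚ) / (k : ℚ) ^ 2, ?_⟩
    have hk0 : (k : ℝ) ≠ 0 := by positivity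
    push_cast
    rw [div_eq_iff (by positivity)]
    linarith
  · filter_upwards [h] with k hk
    rw [abs_sub_round_eq_norm]
    convert hk using 2
    rw [← AddCircle.coe_nsmul]
    simp

/-! ### Digit sets -/

/-- The number in `[0, 1]` whose base `n + 1` digits are the given base `n` digits. -/
noncomputable def sparseDigits {n : ℕ} (a : ℕ → Fin n) : ℝ := Real.ofDigits fun i => (a i).castSucc

theorem ofDigits_eq_head_add {b : ℕ} (a : ℕ → Fin b) :
    Real.ofDigits a = ((a 0 : ℕ) + Real.ofDigits fun i => a (i + 1)) / b := by
  rw [Real.ofDigits_eq_sum_add_ofDigits a 1]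
  simp [Real.ofDigitsTerm]
  ring

/-- The digit `n` never occurs, so every digit can be raised by one. The result is still at most 1
and exceeds the original by `0.111…`, which is at least `1 / (n + 1)`. -/
theorem sparseDigits_le {n : ℕ} (a : ℕ → Fin n) : sparseDigits a ≤ 1 - 1 / (n + 1) := by
  have hsucc : Real.ofDigits (fun i => (a i).succ) =
      sparseDigits a + Real.ofDigits fun _ : ℕ => (⟨1, by have := (a 0).pos; omega⟩ : Fin (n + 1)) := by
    rw [sparseDigits, Real.ofDigits, Real.ofDigits, Real.ofDigits,
      ← Summable.tsum_add Real.summable_ofDigitsTerm Real.summable_ofDigitsTerm]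
    refine tsum_congr fun i => ?_
    simp [Real.ofDigitsTerm]
    ring
  have h1 := Real.ofDigits_le_one fun i => (a i).succ
  have h2 : (1 : ℝ) / (n + 1) ≤
      Real.ofDigits fun _ : ℕ => (⟨1, by have := (a 0).pos; omega⟩ : Fin (n + 1)) := by
    rw [ofDigits_eq_head_add]
    have := Real.ofDigits_nonneg fun _ : ℕ => (⟨1, by have := (a 0).pos; omega⟩ : Fin (n + 1))
    push_cast
    gcongr
    linarith
  linarith

/-- The missing top digit keeps the tail of the smaller number away from 1, which leaves a gap. The
exponent counts the `m` common digits, the differing one and the gap of `1 / (n + 1)`. -/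
theorem le_abs_sparseDigits_sub {n m : ℕ} {a b : ℕ → Fin n} (h : ∀ i < m, a i = b i)
    (hm : a m ≠ b m) : (((n : ℝ) + 1) ^ (m + 2))⁻¹ ≤ |sparseDigits a - sparseDigits b| := by
  wlog hlt : b m < a m generalizing a b
  · rw [abs_sub_comm]
    exact this (fun i hi => (h i hi).symm) hm.symm (lt_of_le_of_ne (not_lt.mp hlt) hm)
  refine le_trans ?_ (le_abs_self _)
  have hterm : ∑ i ∈ Finset.range m, Real.ofDigitsTerm (fun i => (a i).castSucc) i =
      ∑ i ∈ Finset.range m, Real.ofDigitsTerm (fun i => (b i).castSucc) i :=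
    Finset.sum_congr rfl fun i hi => by simp [Real.ofDigitsTerm, h i (Finset.mem_range.mp hi)]
  have hb := sparseDigits_le fun i => b (i + 1 + m)
  have ha := Real.ofDigits_nonneg fun i => (a (i + 1 + m)).castSucc
  have hab : ((b m : ℕ) : ℝ) + 1 ≤ (a m : ℕ) := by exact_mod_cast hlt
  rw [sparseDigits] at hb
  rw [sparseDigits, sparseDigits, Real.ofDigits_eq_sum_add_ofDigits _ m,
    Real.ofDigits_eq_sum_add_ofDigits (fun i => (b i).castSucc) m, hterm,
    add_sub_add_left_eq_sub, ← mul_sub, ofDigits_eq_head_add,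
    ofDigits_eq_head_add fun i => (b (i + m)).castSucc, ← sub_div, pow_add, mul_inv]
  push_cast
  simp only [zero_add, Fin.val_castSucc]
  gcongr
  rw [pow_two, mul_inv, ← div_eq_mul_inv]
  gcongr
  rw [inv_eq_one_div]
  linarith

/-- The base change `sparseDigits a ↦ ofDigits a` is Hölder continuous. -/
theorem abs_ofDigits_sub_le {n : ℕ} (hn : 2 ≤ n) (a b : ℕ → Fin n) :
    |Real.ofDigits a - Real.ofDigits b| ≤
      (n : ℝ) ^ 2 * |sparseDigits a - sparseDigits b| ^ (Real.log n / Real.log (n + 1)) := by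
  by_cases hab : a = b
  · rw [hab, sub_self, abs_zero]
    positivity
  have hn0 : (0 : ℝ) < n := by positivity
  have hlog : 0 < Real.log (n + 1) := Real.log_pos (by linarith)
  have hα : 0 ≤ Real.log n / Real.log (n + 1) :=
    div_nonneg (Real.log_natCast_nonneg n) hlog.le
  -- The Hölder exponent is chosen to turn the scale `(n + 1) ^ -m` into `n ^ -m`.
  have hpow : ((n : ℝ) + 1) ^ (Real.log n / Real.log (n + 1)) = n := by
    rw [Real.rpow_def_of_pos (by positivity), mul_div_cancel₀ _ hlog.ne', Real.exp_log hn0]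
  set m := PiNat.firstDiff (E := fun _ => Fin n) a b with hm
  have h1 := Real.abs_ofDigits_sub_ofDigits_le (x := a) (y := b) (n := m) fun i hi =>
    PiNat.apply_eq_of_lt_firstDiff (E := fun _ => Fin n) hi
  have h2 := le_abs_sparseDigits_sub (m := m) (fun i hi =>
    PiNat.apply_eq_of_lt_firstDiff (E := fun _ => Fin n) hi)
    (PiNat.apply_firstDiff_ne (E := fun _ => Fin n) hab)
  have h3 := Real.rpow_le_rpow (by positivity) h2 hα
  rw [Real.inv_rpow (by positivity), ← Real.rpow_natCast, ← Real.rpow_mul (by positivity),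
    mul_comm _ (Real.log n / _), Real.rpow_mul (by positivity), hpow, Real.rpow_natCast] at h3
  calc _ ≤ ((n : ℝ) ^ m)⁻¹ := h1
    _ = (n : ℝ) ^ 2 * ((n : ℝ) ^ (m + 2))⁻¹ := by field_simp; ring
    _ ≤ _ := by gcongr

/-- Self-similarity: the set is covered by `n` copies of itself scaled by `1 / (n + 1)`, so its
finite measure is at most `n / (n + 1)` times itself. -/
theorem volume_range_sparseDigits (n : ℕ) :
    volume (Set.range (sparseDigits : (ℕ → Fin n) → ℝ)) = 0 := by
  set N := Set.range (sparseDigits : (ℕ → Fin n) → ℝ) with hN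
  have hfin : volume N ≠ ∞ := by
    refine ne_top_of_le_ne_top (b := volume (Set.Icc (0 : ℝ) 1)) (by simp) (measure_mono ?_)
    rintro _ ⟨a, rfl⟩
    exact ⟨Real.ofDigits_nonneg _, Real.ofDigits_le_one _⟩
  have hsub : N ⊆ ⋃ d : Fin n, (fun x : ℝ => ((n : ℝ) + 1) * x - (d : ℕ)) ⁻¹' N := by
    rintro _ ⟨a, rfl⟩
    refine Set.mem_iUnion.mpr ⟨a 0, fun i => a (i + 1), ?_⟩
    have := ofDigits_eq_head_add fun i => (a i).castSucc
    simp only [sparseDigits]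
    rw [this]
    push_cast
    rw [mul_div_cancel₀ _ (by positivity), Fin.val_castSucc]
    ring
  have hvol : ∀ d : Fin n, volume ((fun x : ℝ => ((n : ℝ) + 1) * x - (d : ℕ)) ⁻¹' N) =
      ENNReal.ofReal ((n : ℝ) + 1)⁻¹ * volume N := by
    intro d
    have : (fun x : ℝ => ((n : ℝ) + 1) * x - (d : ℕ)) ⁻¹' N =
        (fun x : ℝ => ((n : ℝ) + 1) * x) ⁻¹' ((fun x : ℝ => x - (d : ℕ)) ⁻¹' N) := rfl
    rw [this, Real.volume_preimage_mul_left (by positivity), abs_of_pos (by positivity)]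
    simp only [sub_eq_add_neg]
    rw [measure_preimage_add_right]
  have hle : volume N ≤ n * (ENNReal.ofReal ((n : ℝ) + 1)⁻¹ * volume N) := by
    refine (measure_mono hsub).trans ((measure_iUnion_fintype_le _ _).trans ?_)
    simp [hvol]
  have hreal := ENNReal.toReal_mono (by finiteness) hle
  rw [ENNReal.toReal_mul, ENNReal.toReal_mul, ENNReal.toReal_natCast,
    ENNReal.toReal_ofReal (by positivity), ← mul_assoc, ← div_eq_mul_inv] at hreal
  have hlt : (n : ℝ) / (n + 1) < 1 := (div_lt_one (by positivity)).mpr (lt_add_one _)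
  have h0 : 0 ≤ (volume N).toReal := ENNReal.toReal_nonneg
  exact ((ENNReal.toReal_eq_zero_iff _).mp (by nlinarith)).resolve_right hfin

/-! ### Hausdorff dimension of products with digit sets -/

/-- The map `g × id` is `α`-Hölder on `N × T`, and its image contains `[0, 1] × T`, which has
nonzero area and hence dimension at least 2. An `α`-Hölder map multiplies dimension by at most `1 /
α`. -/
theorem two_mul_le_dimH_prod {N T : Set ℝ} {g : ℝ → ℝ} {C α : ℝ≥0} (hα : 0 < α) (hα1 : α ≤ 1)
    (hg : HolderOnWith C α g N) (hgN : Set.Icc 0 1 ⊆ g '' N) (hT1 : T ⊆ Set.Icc 0 1)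
    (hT : volume T ≠ 0) : 2 * (α : ℝ≥0∞) ≤ dimH (N ×ˢ T) := by
  have h1 : (2 : ℝ≥0∞) ≤ dimH (Set.Icc (0 : ℝ) 1 ×ˢ T) := by
    refine le_dimH_of_hausdorffMeasure_ne_zero (d := 2) ?_
    have : (μH[((2 : ℝ≥0) : ℝ)] : Measure (ℝ × ℝ)) = volume := hausdorffMeasure_prod_real
    rw [this, Measure.volume_eq_prod, Measure.prod_prod]
    simpa using hT
  have h2 : HolderOnWith (max C 1) α (Prod.map g id) (N ×ˢ T) := by
    rintro ⟨x, u⟩ ⟨hx, hu⟩ ⟨y, v⟩ ⟨hy, hv⟩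
    rw [Prod.edist_eq]
    refine max_le ?_ ?_
    · refine (hg x hx y hy).trans ?_
      gcongr
      · exact le_max_left _ _
      · rw [Prod.edist_eq]; exact le_max_left _ _
    -- Distances at most 1 do not decrease when raised to a power `α ≤ 1`, so the identity is also
    -- `α`-Hölder on `T`.
    · have huv : edist u v ≤ 1 := by
        rw [edist_dist, Real.dist_eq, ENNReal.ofReal_le_one]
        have hu := hT1 hu
        have hv := hT1 hv
        exact abs_sub_le_iff.mpr ⟨by linarith [hu.2, hv.1], by linarith [hv.2, hu.1]⟩
      calc edist u v = edist u v ^ (1 : ℝ) := (ENNReal.rpow_one _).symm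
        _ ≤ edist u v ^ (α : ℝ) := ENNReal.rpow_le_rpow_of_exponent_ge huv (by exact_mod_cast hα1)
        _ = (1 : ℝ≥0) * edist u v ^ (α : ℝ) := by simp
        _ ≤ _ := by
          gcongr
          · exact le_max_right _ _
          · rw [Prod.edist_eq]; exact le_max_right _ _
  have h3 := h2.dimH_image_le hα
  have h4 : Set.Icc (0 : ℝ) 1 ×ˢ T ⊆ Prod.map g id '' (N ×ˢ T) := by
    rw [Set.prodMap_image_prod, Set.image_id]
    exact Set.prod_mono hgN le_rfl
  have h5 := (h1.trans (dimH_mono h4)).trans h3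
  rwa [ENNReal.le_div_iff_mul_le (by simp [hα.ne']) (by simp)] at h5

theorem two_mul_le_dimH_range_sparseDigits_prod {n : ℕ} (hn : 2 ≤ n) {T : Set ℝ}
    (hT1 : T ⊆ Set.Icc 0 1) (hT : volume T ≠ 0) :
    ENNReal.ofReal (2 * (Real.log n / Real.log (n + 1))) ≤
      dimH (Set.range (sparseDigits : (ℕ → Fin n) → ℝ) ×ˢ T) := by
  have hn' : (2 : ℝ) ≤ n := by exact_mod_cast hn
  have hlogn : 0 < Real.log n := Real.log_pos (by linarith)
  have hlog : Real.log n ≤ Real.log (n + 1) := Real.log_le_log (by linarith) (by linarith)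
  obtain ⟨α, hα⟩ : ∃ α : ℝ≥0, (α : ℝ) = Real.log n / Real.log (n + 1) :=
    ⟨⟨_, (div_pos hlogn (hlogn.trans_le hlog)).le⟩, rfl⟩
  have hαpos : 0 < α := by
    rw [← NNReal.coe_pos, hα]
    exact div_pos hlogn (hlogn.trans_le hlog)
  have hα1 : α ≤ 1 := by
    rw [← NNReal.coe_le_coe, hα]
    exact div_le_one_of_le₀ hlog (hlogn.le.trans hlog)
  have : NeZero n := ⟨by omega⟩
  let g : ℝ → ℝ := fun x => Real.ofDigits (Function.invFun (sparseDigits (n := n)) x)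
  have hinv : ∀ a : ℕ → Fin n,
      sparseDigits (Function.invFun (sparseDigits (n := n)) (sparseDigits a)) = sparseDigits a :=
    fun a => Function.invFun_eq ⟨a, rfl⟩
  have hg : HolderOnWith ((n : ℝ≥0) ^ 2) α g (Set.range (sparseDigits (n := n))) := by
    rintro _ ⟨a, rfl⟩ _ ⟨b, rfl⟩
    have := abs_ofDigits_sub_le hn (Function.invFun (sparseDigits (n := n)) (sparseDigits a))
      (Function.invFun (sparseDigits (n := n)) (sparseDigits b))
    rw [hinv, hinv, ← hα] at this
    rw [edist_dist, edist_dist, Real.dist_eq, Real.dist_eq,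
      ENNReal.ofReal_rpow_of_nonneg (abs_nonneg _) α.coe_nonneg]
    refine (ENNReal.ofReal_le_ofReal this).trans (le_of_eq ?_)
    rw [ENNReal.ofReal_mul (by positivity)]
    congr 1
    rw [← ENNReal.ofReal_coe_nnreal]
    simp
  have hgN : Set.Icc 0 1 ⊆ g '' Set.range (sparseDigits (n := n)) := by
    intro y hy
    obtain ⟨a, -, rfl⟩ := Real.ofDigits_SurjOn (b := n) (by omega) hy
    refine ⟨_, ⟨a, rfl⟩, ?_⟩
    -- The Hölder bound at distance 0 shows that the base change does not depend on the chosen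
    -- preimage.
    have := abs_ofDigits_sub_le hn (Function.invFun (sparseDigits (n := n)) (sparseDigits a)) a
    rw [hinv, ← hα, sub_self, abs_zero, Real.zero_rpow (by exact_mod_cast hαpos.ne'), mul_zero] at this
    exact sub_eq_zero.mp (abs_nonpos_iff.mp this)
  have := two_mul_le_dimH_prod hαpos hα1 hg hgN hT1 hT
  rwa [← hα, ENNReal.ofReal_mul (by norm_num), ENNReal.ofReal_coe_nnreal, ENNReal.ofReal_ofNat]

theorem tendsto_log_div_log_add_one :
    Tendsto (fun n : ℕ => Real.log n / Real.log (n + 1)) atTop (𝓝 1) := by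
  have h1 : Tendsto (fun n : ℕ => Real.log ((n : ℝ) + 1)) atTop atTop :=
    Real.tendsto_log_atTop.comp (tendsto_atTop_add_const_right _ _ tendsto_natCast_atTop_atTop)
  have h2 := (Real.tendsto_log_nat_add_one_sub_log.div_atTop h1).const_sub 1
  rw [sub_zero] at h2
  refine h2.congr' ?_
  filter_upwards [h1.eventually_gt_atTop 0] with n hn
  field_simp
  ring

/-- The shear `(u, v) ↦ (u, u - a v)`. -/
noncomputable def shear (a : ℝ) (ha : a ≠ 0) : (ℝ × ℝ) ≃L[ℝ] (ℝ × ℝ) :=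
  LinearEquiv.toContinuousLinearEquiv
    { toFun := fun p => (p.1, p.1 - a * p.2)
      invFun := fun p => (p.1, (p.1 - p.2) / a)
      map_add' := fun p q => by ext <;> simp; ring
      map_smul' := fun t p => by ext <;> simp; ring
      left_inv := fun p => by ext <;> simp [ha]
      right_inv := fun p => by
        ext
        · rfl
        · change p.1 - a * ((p.1 - p.2) / a) = p.2
          field_simp
          ring }

/-- A conull set of differences contains a null set of pairs of full Hausdorff dimension. -/
theorem exists_null_dimH_eq_two {a : ℝ} (ha : a ≠ 0) {G : Set ℝ} (hG : ∀ᵐ x, x ∈ G) :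
    ∃ S : Set (ℝ × ℝ), (∀ p ∈ S, (p.1 - p.2) / a ∈ G) ∧ volume S = 0 ∧ dimH S = 2 := by
  set N : Set ℝ := ⋃ n : ℕ, Set.range (sparseDigits (n := n)) with hN
  have hT : volume (G ∩ Set.Icc 0 1) ≠ 0 := by
    have : volume (G ∩ Set.Icc (0 : ℝ) 1) = volume (Set.Icc (0 : ℝ) 1) :=
      measure_congr (by filter_upwards [hG] with x hx; exact propext ⟨fun h => h.2, fun h => ⟨hx, h⟩⟩)
    rw [this]
    simp
  -- The first coordinate makes the set null; the pieces of `N` give dimension at least `2 log n /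
  -- log (n + 1)` for every `n ≥ 2`, which tends to 2.
  refine ⟨{p | p.1 ∈ N ∧ (p.1 - p.2) / a ∈ G}, fun p hp => hp.2, ?_, le_antisymm ?_ ?_⟩
  · refine measure_mono_null (t := N ×ˢ Set.univ) (fun p hp => ⟨hp.1, trivial⟩) ?_
    rw [Measure.volume_eq_prod, Measure.prod_prod,
      measure_iUnion_null fun n => volume_range_sparseDigits n, zero_mul]
  · refine (dimH_mono (Set.subset_univ _)).trans (le_of_eq ?_)
    rw [Real.dimH_univ_eq_finrank]
    simp
  · have hlim : Tendsto (fun n : ℕ => ENNReal.ofReal (2 * (Real.log n / Real.log (n + 1)))) atTop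
        (𝓝 2) := by
      have := ENNReal.tendsto_ofReal (tendsto_log_div_log_add_one.const_mul 2)
      simpa using this
    refine le_of_tendsto hlim ?_
    filter_upwards [eventually_ge_atTop 2] with n hn
    refine (two_mul_le_dimH_range_sparseDigits_prod hn Set.inter_subset_right hT).trans ?_
    -- The shear preserves dimension and sends `(u, v)` to a pair with first entry `u` and scaled
    -- difference `v`.
    rw [← (shear a ha).dimH_image]
    refine dimH_mono ?_
    rintro _ ⟨⟨u, v⟩, ⟨hu, hv⟩, rfl⟩
    refine ⟨Set.mem_iUnion.mpr ⟨n, hu⟩, ?_⟩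
    change (u - (u - a * v)) / a ∈ G
    rw [sub_sub_cancel, mul_div_cancel_left₀ _ ha]
    exact hv.1

theorem ae_prod_sub_div {a : ℝ} (ha : a ≠ 0) {G : Set ℝ} (hG : ∀ᵐ x, x ∈ G) :
    ∀ᵐ p : ℝ × ℝ, (p.1 - p.2) / a ∈ G := by
  have h1 : ∀ᵐ x : ℝ, x / a ∈ G := by
    have := (Measure.quasiMeasurePreserving_smul (volume : Measure ℝ) (inv_ne_zero ha)).ae hG
    filter_upwards [this] with x hx
    rw [div_eq_inv_mul]
    exact hx
  have h2 : Measure.QuasiMeasurePreserving (fun p : ℝ × ℝ => p.1 - p.2) volume volume :=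
    quasiMeasurePreserving_sub volume volume
  exact h2.ae h1

end DiophantineNullSets

/-! ### Single modes and their oscillations -/

namespace HingedBeam

/-- The continuous functional that reads off the `k`-th sine coefficient. -/
noncomputable def coeffCLM (s : ℝ) (k : ℕ+) : D s →L[ℂ] ℂ :=
  LinearMap.mkContinuous ((LinearMap.proj k).comp (coeff s)) ((k : ℝ) ^ s)⁻¹ fun f => by
    have h1 : (k : ℝ) ^ (2 * s) * ‖coeff s f k‖ ^ 2 ≤ ‖f‖ ^ 2 := by
      rw [norm_sq_eq]
      exact (summable_coeff s f).le_tsum k fun j _ => by positivity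
    have h2 : ((k : ℝ) ^ s * ‖coeff s f k‖) ^ 2 ≤ ‖f‖ ^ 2 := by
      refine le_trans (le_of_eq ?_) h1
      rw [mul_pow, ← Real.rpow_mul_natCast (by positivity)]
      congr 2
      push_cast
      ring
    have hk := weight_pos s k
    have h3 := (sq_le_sq₀ (by positivity) (norm_nonneg f)).mp h2
    change ‖coeff s f k‖ ≤ _
    rwa [inv_mul_eq_div, le_div_iff₀ hk, mul_comm]

theorem coeffCLM_apply (s : ℝ) (k : ℕ+) (f : D s) : coeffCLM s k f = coeff s f k := rfl

/-- The element `a sin (k x)` of `D^s`. -/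
noncomputable def mode (s : ℝ) (k : ℕ+) (a : ℂ) : D s :=
  ofCoeff s (Pi.single k a) <| summable_of_ne_finset_zero (s := {k}) fun j hj => by
    rw [Pi.single_eq_of_ne (by simpa using hj), norm_zero, zero_pow two_ne_zero, mul_zero]

theorem coeff_mode (s : ℝ) (k : ℕ+) (a : ℂ) : coeff s (mode s k a) = Pi.single k a := rfl

theorem norm_mode (s : ℝ) (k : ℕ+) (a : ℂ) : ‖mode s k a‖ = (k : ℝ) ^ s * ‖a‖ := by
  have hk := weight_pos s k
  rw [← sq_eq_sq₀ (norm_nonneg _) (by positivity), norm_sq_eq, tsum_eq_single k, coeff_mode,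
    Pi.single_eq_same, mul_pow, ← Real.rpow_mul_natCast (by positivity)]
  · congr 2
    push_cast
    ring
  · intro j hj
    rw [coeff_mode, Pi.single_eq_of_ne hj, norm_zero, zero_pow two_ne_zero, mul_zero]

theorem incl_mode {s s' : ℝ} (h : s' ≤ s) (k : ℕ+) (a : ℂ) :
    incl h (mode s k a) = mode s' k a := by
  apply coeff_injective
  rw [coeff_incl, coeff_mode, coeff_mode]

theorem mode_eq_smul (s : ℝ) (k : ℕ+) (a : ℂ) : mode s k a = a • mode s k 1 := by
  apply coeff_injective
  rw [map_smul, coeff_mode, coeff_mode, ← Pi.single_smul, smul_eq_mul, mul_one]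

theorem fourthDeriv_mode (s : ℝ) (k : ℕ+) (a : ℂ) :
    fourthDeriv s (mode s k a) = mode (s - 4) k ((k : ℂ) ^ 4 * a) := by
  apply coeff_injective
  funext j
  rw [coeff_fourthDeriv, coeff_mode, coeff_mode]
  by_cases hj : j = k
  · subst hj; simp
  · simp [hj]

/-- The general real oscillation of frequency `w`. -/
noncomputable def oscillation (w A B : ℝ) (t : ℝ) : ℝ := A * Real.cos (w * t) + B * Real.sin (w * t)

theorem hasDerivAt_oscillation (w A B t : ℝ) :
    HasDerivAt (oscillation w A B) (oscillation w (w * B) (-(w * A)) t) t := by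
  have h := (hasDerivAt_id t).const_mul w
  refine ((h.cos.const_mul A).add (h.sin.const_mul B)).congr_deriv ?_
  simp only [oscillation, id]
  ring

theorem contDiff_oscillation (w A B : ℝ) (n : WithTop ℕ∞) : ContDiff ℝ n (oscillation w A B) := by
  unfold oscillation
  fun_prop

theorem hasDerivAt_mode_oscillation (s : ℝ) (k : ℕ+) (w A B t : ℝ) :
    HasDerivAt (fun t => mode s k (oscillation w A B t))
      (mode s k (oscillation w (w * B) (-(w * A)) t)) t := by
  have h := (hasDerivAt_oscillation w A B t).ofReal_comp.smul_const (mode s k 1)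
  simp only [mode_eq_smul s k (Complex.ofReal _)]
  exact h

theorem contDiff_mode_oscillation (s : ℝ) (k : ℕ+) (w A B : ℝ) (n : WithTop ℕ∞) :
    ContDiff ℝ n fun t => mode s k (oscillation w A B t) := by
  simp only [mode_eq_smul s k (Complex.ofReal _)]
  exact (Complex.ofRealCLM.contDiff.comp (contDiff_oscillation w A B n)).smul contDiff_const

/-- The frequency is `k²` because `∂_x^4` acts on the mode as `k⁴`. These are the test solutions for
necessity. -/
theorem isSolution_mode_oscillation (s : ℝ) (k : ℕ+) (A B : ℝ) :
    IsSolution s (mode s k A) (mode (s - 2) k ((k : ℝ) ^ 2 * B : ℝ))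
      fun t => mode s k (oscillation ((k : ℝ) ^ 2) A B t) where
  continuous := (contDiff_mode_oscillation s k _ A B 0).continuous
  contDiff_one := by
    simp only [incl_mode]
    exact contDiff_mode_oscillation _ k _ A B 1
  contDiff_two := by
    simp only [incl_mode]
    exact contDiff_mode_oscillation _ k _ A B 2
  equation t := by
    simp only [incl_mode]
    have hd : ∀ A B : ℝ, deriv (fun t => mode (s - 4) k (oscillation ((k : ℝ) ^ 2) A B t)) =
        fun t => mode (s - 4) k (oscillation ((k : ℝ) ^ 2) ((k : ℝ) ^ 2 * B) (-((k : ℝ) ^ 2 * A)) t) :=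
      fun A B => funext fun t => (hasDerivAt_mode_oscillation _ k _ A B t).deriv
    rw [iteratedDeriv_succ, iteratedDeriv_one, hd, hd, fourthDeriv_mode]
    apply coeff_injective
    rw [map_add, coeff_mode, coeff_mode, ← Pi.single_add, map_zero]
    refine (congrArg (Pi.single k) ?_).trans (Pi.single_zero k)
    simp only [oscillation]
    push_cast
    ring
  initial_position := by simp [oscillation]
  initial_velocity := by
    simp only [incl_mode]
    rw [(hasDerivAt_mode_oscillation _ k _ A B 0).deriv]
    simp [oscillation]

/-! ### Coefficients of an arbitrary solution -/

/-- Uniqueness for the complex harmonic oscillator. -/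
theorem eq_cos_add_sin_of_deriv_deriv {w : ℝ} (hw : w ≠ 0) {c c' : ℝ → ℂ}
    (h1 : ∀ t, HasDerivAt c (c' t) t) (h2 : ∀ t, HasDerivAt c' (-((w : ℂ) ^ 2 * c t)) t) (t : ℝ) :
    c t = c 0 * Real.cos (w * t) + c' 0 / w * Real.sin (w * t) := by
  have hw' : (w : ℂ) ≠ 0 := Complex.ofReal_ne_zero.mpr hw
  have hcos : ∀ t : ℝ, HasDerivAt (fun t : ℝ => (Real.cos (w * t) : ℂ))
      (-(w * (Real.sin (w * t) : ℂ))) t := fun t => by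
    refine ((hasDerivAt_id t).const_mul w).cos.ofReal_comp.congr_deriv ?_
    push_cast [id]
    ring
  have hsin : ∀ t : ℝ, HasDerivAt (fun t : ℝ => (Real.sin (w * t) : ℂ))
      (w * (Real.cos (w * t) : ℂ)) t := fun t => by
    refine ((hasDerivAt_id t).const_mul w).sin.ofReal_comp.congr_deriv ?_
    push_cast [id]
    ring
  -- First integrals: the vector `(w c, c')` rotated back by the angle `w t` is constant.
  have hP : ∀ t : ℝ, HasDerivAt
      (fun t : ℝ => w * c t * (Real.cos (w * t) : ℂ) - c' t * (Real.sin (w * t) : ℂ)) 0 t :=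
    fun t => ((((h1 t).const_mul (w : ℂ)).mul (hcos t)).sub ((h2 t).mul (hsin t))).congr_deriv
      (by ring)
  have hQ : ∀ t : ℝ, HasDerivAt
      (fun t : ℝ => w * c t * (Real.sin (w * t) : ℂ) + c' t * (Real.cos (w * t) : ℂ)) 0 t :=
    fun t => ((((h1 t).const_mul (w : ℂ)).mul (hsin t)).add ((h2 t).mul (hcos t))).congr_deriv
      (by ring)
  have eP := is_const_of_deriv_eq_zero (fun t => (hP t).differentiableAt) (fun t => (hP t).deriv) t 0
  have eQ := is_const_of_deriv_eq_zero (fun t => (hQ t).differentiableAt) (fun t => (hQ t).deriv) t 0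
  simp only [mul_zero, Real.cos_zero, Real.sin_zero, Complex.ofReal_one, Complex.ofReal_zero,
    mul_one, sub_zero, zero_add] at eP eQ
  have hcs : (Real.cos (w * t) : ℂ) ^ 2 + (Real.sin (w * t) : ℂ) ^ 2 = 1 := by
    exact_mod_cast Real.cos_sq_add_sin_sq (w * t)
  have key : w * c t = w * c 0 * (Real.cos (w * t) : ℂ) + c' 0 * (Real.sin (w * t) : ℂ) := by
    linear_combination (-(w * c t)) * hcs + (Real.cos (w * t) : ℂ) * eP + (Real.sin (w * t) : ℂ) * eQ
  field_simp
  linear_combination key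

/-- A continuous coefficient functional turns the equation in `D (s - 4)` into a scalar oscillator
of frequency `k²`. -/
theorem IsSolution.coeff_eq {s : ℝ} {y₀ : D s} {y₁ : D (s - 2)} {y : ℝ → D s}
    (h : IsSolution s y₀ y₁ y) (k : ℕ+) (t : ℝ) :
    coeff s (y t) k = coeff s y₀ k * Real.cos ((k : ℝ) ^ 2 * t) +
      coeff (s - 2) y₁ k / (k : ℂ) ^ 2 * Real.sin ((k : ℝ) ^ 2 * t) := by
  set z : ℝ → D (s - 4) := fun t => incl (show s - 4 ≤ s by linarith) (y t) with hz
  set v : ℝ → D (s - 2) := fun t => incl (show s - 2 ≤ s by linarith) (y t) with hv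
  have hk : (k : ℝ) ^ 2 ≠ 0 := by have := k.pos; positivity
  have hcz : ∀ t, coeff s (y t) k = coeffCLM (s - 4) k (z t) := fun t => by
    rw [coeffCLM_apply, hz, coeff_incl]
  have hcv : ∀ t, coeff s (y t) k = coeffCLM (s - 2) k (v t) := fun t => by
    rw [coeffCLM_apply, hv, coeff_incl]
  have hz1 : ∀ t, HasDerivAt z (deriv z t) t := fun t =>
    (h.contDiff_two.differentiable (by norm_num) t).hasDerivAt
  have hz2 : ∀ t, HasDerivAt (deriv z) (-fourthDeriv s (y t)) t := fun t => by
    have hd : ContDiff ℝ 1 (deriv z) :=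
      ((contDiff_succ_iff_deriv (n := 1)).mp (by simpa [one_add_one_eq_two] using h.contDiff_two)).2.2
    have := (hd.differentiable (by norm_num) t).hasDerivAt
    have he := h.equation t
    rw [iteratedDeriv_succ, iteratedDeriv_one] at he
    rwa [← eq_neg_of_add_eq_zero_left he]
  have hc1 : ∀ t, HasDerivAt (fun t => coeff s (y t) k) (coeffCLM (s - 4) k (deriv z t)) t :=
    fun t => by
      simp only [hcz]
      exact ((coeffCLM (s - 4) k).restrictScalars ℝ).hasFDerivAt.comp_hasDerivAt t (hz1 t)
  have hc2 : ∀ t, HasDerivAt (fun t => coeffCLM (s - 4) k (deriv z t))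
      (-((((k : ℝ) ^ 2 : ℝ) : ℂ) ^ 2 * coeff s (y t) k)) t := fun t => by
    refine (((coeffCLM (s - 4) k).restrictScalars ℝ).hasFDerivAt.comp_hasDerivAt t
      (hz2 t)).congr_deriv ?_
    change coeffCLM (s - 4) k (-fourthDeriv s (y t)) = _
    rw [map_neg, coeffCLM_apply, coeff_fourthDeriv]
    push_cast
    ring
  have hv1 : HasDerivAt v y₁ 0 := by
    rw [← h.initial_velocity]
    exact (h.contDiff_one.differentiable (by norm_num) 0).hasDerivAt
  -- The initial velocity is given in `D (s - 2)`. Inclusions preserve coefficients, so both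
  -- derivatives are that of the same scalar function.
  have hc0 : coeffCLM (s - 4) k (deriv z 0) = coeff (s - 2) y₁ k := by
    refine (hc1 0).unique ?_
    simp only [hcv]
    exact ((coeffCLM (s - 2) k).restrictScalars ℝ).hasFDerivAt.comp_hasDerivAt 0 hv1
  rw [eq_cos_add_sin_of_deriv_deriv hk hc1 hc2 t, hc0, h.initial_position]
  push_cast
  rfl

/-! ### Observability and the Diophantine condition -/

/-- Jordan's inequality, after a shift by a multiple of `π` into `[-π/2, π/2]`. -/
theorem two_mul_abs_sub_round_le_abs_sin (x : ℝ) :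
    2 * |x - round x| ≤ |Real.sin (Real.pi * x)| := by
  have h : |Real.pi * (x - round x)| ≤ Real.pi / 2 := by
    rw [abs_mul, abs_of_pos Real.pi_pos]
    nlinarith [abs_sub_round x, Real.pi_pos]
  have h1 := Real.mul_abs_le_abs_sin h
  have h2 : Real.pi * (x - round x) = Real.pi * x - (round x : ℤ) * Real.pi := by ring
  rw [h2, Real.sin_sub_int_mul_pi, ← h2, abs_mul ((-1) ^ _), abs_neg_one_zpow, one_mul, abs_mul,
    abs_of_pos Real.pi_pos] at h1
  refine le_trans (le_of_eq ?_) h1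
  field_simp [Real.pi_ne_zero]

theorem abs_sin_le_pi_mul_abs_sub_round (x : ℝ) :
    |Real.sin (Real.pi * x)| ≤ Real.pi * |x - round x| := by
  have h1 := Real.abs_sin_le_abs (x := Real.pi * (x - round x))
  have h2 : Real.pi * (x - round x) = Real.pi * x - (round x : ℤ) * Real.pi := by ring
  rwa [h2, Real.sin_sub_int_mul_pi, ← h2, abs_mul ((-1) ^ _), abs_neg_one_zpow, one_mul, abs_mul,
    abs_of_pos Real.pi_pos] at h1

/-- The diophantine condition satisfied by a strategic pair, obtained from solutions in a single
mode that vanish at `t₀`. -/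
theorem IsStrategicPair.exists_le_abs_sub_round {r s : ℝ} {hsr : s ≤ r} {t₀ t₁ : ℝ}
    (h : IsStrategicPair r s hsr (t₀, t₁)) : ∃ c : ℝ, 0 < c ∧ ∀ k : ℕ+,
      c * (k : ℝ) ^ (-(r - s)) ≤ |(k : ℝ) ^ 2 * (t₀ - t₁) / Real.pi -
        round ((k : ℝ) ^ 2 * (t₀ - t₁) / Real.pi)| := by
  obtain ⟨c, hc, H⟩ := h
  have hπ := Real.pi_pos
  refine ⟨(c * Real.pi)⁻¹, by positivity, fun k => ?_⟩
  have hk : (0 : ℝ) < k := by exact_mod_cast k.pos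
  -- These amplitudes give the oscillation `sin (k² (t₀ - t))`, which vanishes at `t₀`.
  set A := Real.sin ((k : ℝ) ^ 2 * t₀) with hA
  set B := -Real.cos ((k : ℝ) ^ 2 * t₀) with hB
  have h1 := H _ _ _ (isSolution_mode_oscillation r k A B)
  have hy0 : oscillation ((k : ℝ) ^ 2) A B t₀ = 0 := by
    rw [oscillation, hA, hB]
    ring
  have hy1 : oscillation ((k : ℝ) ^ 2) A B t₁ =
      Real.sin (Real.pi * ((k : ℝ) ^ 2 * (t₀ - t₁) / Real.pi)) := by
    rw [mul_div_cancel₀ _ hπ.ne', mul_sub, Real.sin_sub, oscillation, hA, hB]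
    ring
  simp only [hy0, hy1, incl_mode, norm_mode, Complex.norm_real, Real.norm_eq_abs, abs_zero,
    mul_zero, zero_add, abs_mul] at h1
  have hpow : (k : ℝ) ^ (s - 2) * |(k : ℝ) ^ 2| = (k : ℝ) ^ s := by
    rw [abs_of_pos (by positivity), ← Real.rpow_natCast, ← Real.rpow_add hk]
    norm_num
  rw [← mul_assoc ((k : ℝ) ^ (s - 2)), hpow, ← mul_add] at h1
  -- Hence the left side of the observability inequality is at least `k ^ s`.
  have hAB : 1 ≤ |A| + |B| := by
    have hsc : A ^ 2 + B ^ 2 = 1 := by rw [hA, hB, neg_sq, Real.sin_sq_add_cos_sq]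
    nlinarith [abs_nonneg A, abs_nonneg B, sq_abs A, sq_abs B]
  have hks := weight_pos s k
  have hkr := weight_pos r k
  have h2 := abs_sin_le_pi_mul_abs_sub_round ((k : ℝ) ^ 2 * (t₀ - t₁) / Real.pi)
  have h3 : (k : ℝ) ^ s ≤ c * ((k : ℝ) ^ r * (Real.pi * |(k : ℝ) ^ 2 * (t₀ - t₁) / Real.pi -
        round ((k : ℝ) ^ 2 * (t₀ - t₁) / Real.pi)|)) :=
    (le_mul_of_one_le_right hks.le hAB).trans (h1.trans (by gcongr))
  rw [neg_sub, Real.rpow_sub hk, inv_mul_eq_div, div_div, div_le_iff₀ (by positivity)]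
  linarith

/-- Two point values determine the amplitudes of an oscillation. -/
theorem norm_mul_abs_sin_le (A B : ℂ) (x₀ x₁ : ℝ) :
    ‖A‖ * |Real.sin (x₀ - x₁)| ≤ ‖A * Real.cos x₀ + B * Real.sin x₀‖ +
        ‖A * Real.cos x₁ + B * Real.sin x₁‖ ∧
      ‖B‖ * |Real.sin (x₀ - x₁)| ≤ ‖A * Real.cos x₀ + B * Real.sin x₀‖ +
        ‖A * Real.cos x₁ + B * Real.sin x₁‖ := by
  have hle : ∀ (u v : ℂ) (p q : ℝ), |p| ≤ 1 → |q| ≤ 1 → ‖u * p - v * q‖ ≤ ‖u‖ + ‖v‖ := by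
    intro u v p q hp hq
    refine (norm_sub_le _ _).trans (add_le_add ?_ ?_)
    · rw [norm_mul, Complex.norm_real]
      exact mul_le_of_le_one_right (norm_nonneg _) hp
    · rw [norm_mul, Complex.norm_real]
      exact mul_le_of_le_one_right (norm_nonneg _) hq
  constructor
  -- Cramer's rule, with determinant `sin (x₀ - x₁)` up to sign.
  · have e : A * (Real.sin (x₀ - x₁) : ℂ) = (A * Real.cos x₁ + B * Real.sin x₁) * Real.sin x₀ -
        (A * Real.cos x₀ + B * Real.sin x₀) * Real.sin x₁ := by
      rw [Real.sin_sub]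
      push_cast
      ring
    rw [← Real.norm_eq_abs, ← Complex.norm_real, ← norm_mul, e, add_comm ‖_‖]
    exact hle _ _ _ _ (Real.abs_sin_le_one _) (Real.abs_sin_le_one _)
  · have e : B * (Real.sin (x₀ - x₁) : ℂ) = (A * Real.cos x₀ + B * Real.sin x₀) * Real.cos x₁ -
        (A * Real.cos x₁ + B * Real.sin x₁) * Real.cos x₀ := by
      rw [Real.sin_sub]
      push_cast
      ring
    rw [← Real.norm_eq_abs, ← Complex.norm_real, ← norm_mul, e]
    exact hle _ _ _ _ (Real.abs_cos_le_one _) (Real.abs_cos_le_one _)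

/-- A coefficientwise bound by two elements gives a bound of norms. -/
theorem norm_le_of_coeff_le {s r C : ℝ} (hC : 0 ≤ C) (f : D s) (u v : D r)
    (h : ∀ k : ℕ+, (k : ℝ) ^ s * ‖coeff s f k‖ ≤
      C * ((k : ℝ) ^ r * (‖coeff r u k‖ + ‖coeff r v k‖))) :
    ‖f‖ ≤ 2 * C * (‖u‖ + ‖v‖) := by
  have hw : ∀ (t : ℝ) (k : ℕ+) (a : ℝ), (k : ℝ) ^ (2 * t) * a ^ 2 = ((k : ℝ) ^ t * a) ^ 2 := by
    intro t k a
    rw [mul_pow, ← Real.rpow_mul_natCast (by positivity)]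
    congr 2
    push_cast
    ring
  have hsum := ((summable_coeff r u).add (summable_coeff r v)).mul_left (2 * C ^ 2)
  have h2 : ‖f‖ ^ 2 ≤ 2 * C ^ 2 * (‖u‖ ^ 2 + ‖v‖ ^ 2) := by
    rw [norm_sq_eq, norm_sq_eq, norm_sq_eq,
      ← (summable_coeff r u).tsum_add (summable_coeff r v), ← tsum_mul_left]
    refine (summable_coeff s f).tsum_le_tsum (fun k => ?_) hsum
    have hk := weight_pos r k
    have hs := weight_pos s k
    rw [hw, hw, hw]
    refine (pow_le_pow_left₀ (by positivity) (h k) 2).trans ?_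
    have hC2 : 0 ≤ C ^ 2 := sq_nonneg C
    -- This is `(a + b)² ≤ 2 (a² + b²)`; the resulting factor `√2` is later rounded up to 2.
    nlinarith [mul_nonneg hC2
      (sq_nonneg ((k : ℝ) ^ r * ‖coeff r u k‖ - (k : ℝ) ^ r * ‖coeff r v k‖))]
  refine (sq_le_sq₀ (norm_nonneg _) (by positivity)).mp (h2.trans ?_)
  have hu := norm_nonneg u
  have hv := norm_nonneg v
  have hC2 : 0 ≤ C ^ 2 := sq_nonneg C
  nlinarith [mul_nonneg hC2 (mul_nonneg hu hv), mul_nonneg hC2 (sq_nonneg ‖u‖),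
    mul_nonneg hC2 (sq_nonneg ‖v‖)]

theorem isStrategicPair_of_le_abs_sub_round {r s : ℝ} (hsr : s ≤ r) {t₀ t₁ c : ℝ} (hc : 0 < c)
    (h : ∀ k : ℕ+, c * (k : ℝ) ^ (-(r - s)) ≤ |(k : ℝ) ^ 2 * (t₀ - t₁) / Real.pi -
        round ((k : ℝ) ^ 2 * (t₀ - t₁) / Real.pi)|) :
    IsStrategicPair r s hsr (t₀, t₁) := by
  have hsin : ∀ k : ℕ+, c * (k : ℝ) ^ s ≤
      (k : ℝ) ^ r * |Real.sin ((k : ℝ) ^ 2 * t₀ - (k : ℝ) ^ 2 * t₁)| := by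
    intro k
    have hk : (0 : ℝ) < k := by exact_mod_cast k.pos
    have h1 := two_mul_abs_sub_round_le_abs_sin ((k : ℝ) ^ 2 * (t₀ - t₁) / Real.pi)
    rw [mul_div_cancel₀ _ Real.pi_ne_zero, mul_sub] at h1
    have h2 := h k
    rw [neg_sub, Real.rpow_sub hk, mul_sub] at h2
    have h3 : c * ((k : ℝ) ^ s / (k : ℝ) ^ r) ≤
        |Real.sin ((k : ℝ) ^ 2 * t₀ - (k : ℝ) ^ 2 * t₁)| := by
      refine h2.trans (le_trans ?_ h1)
      linarith [abs_nonneg (((k : ℝ) ^ 2 * t₀ - (k : ℝ) ^ 2 * t₁) / Real.pi -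
        round (((k : ℝ) ^ 2 * t₀ - (k : ℝ) ^ 2 * t₁) / Real.pi))]
    rwa [← mul_div_assoc, div_le_iff₀' (weight_pos r k)] at h3
  have hmul : ∀ (k : ℕ+) (a b : ℝ), 0 ≤ a →
      a * |Real.sin ((k : ℝ) ^ 2 * t₀ - (k : ℝ) ^ 2 * t₁)| ≤ b →
      (k : ℝ) ^ s * a ≤ c⁻¹ * ((k : ℝ) ^ r * b) := by
    intro k a b ha hab
    rw [inv_mul_eq_div, le_div_iff₀ hc]
    calc (k : ℝ) ^ s * a * c = c * (k : ℝ) ^ s * a := by ring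
      _ ≤ (k : ℝ) ^ r * |Real.sin ((k : ℝ) ^ 2 * t₀ - (k : ℝ) ^ 2 * t₁)| * a :=
        mul_le_mul_of_nonneg_right (hsin k) ha
      _ = (k : ℝ) ^ r * (a * |Real.sin ((k : ℝ) ^ 2 * t₀ - (k : ℝ) ^ 2 * t₁)|) := by ring
      _ ≤ _ := by gcongr
  refine ⟨4 * c⁻¹, by positivity, fun y₀ y₁ y hy => ?_⟩
  have hk2 : ∀ k : ℕ+, (0 : ℝ) < k := fun k => by exact_mod_cast k.pos
  have n0 : ‖incl hsr y₀‖ ≤ 2 * c⁻¹ * (‖y t₀‖ + ‖y t₁‖) := by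
    refine norm_le_of_coeff_le (by positivity) _ _ _ fun k => ?_
    rw [coeff_incl, hy.coeff_eq, hy.coeff_eq]
    exact hmul k _ _ (norm_nonneg _) (norm_mul_abs_sin_le _ _ _ _).1
  have n1 : ‖incl (sub_le_sub_right hsr 2) y₁‖ ≤ 2 * c⁻¹ * (‖y t₀‖ + ‖y t₁‖) := by
    refine norm_le_of_coeff_le (by positivity) _ _ _ fun k => ?_
    rw [coeff_incl, hy.coeff_eq, hy.coeff_eq]
    -- The sine amplitude is the velocity coefficient over `k²`, which accounts for the index `s -
    -- 2`.
    refine le_trans (le_of_eq ?_) (hmul k _ _ (norm_nonneg _) (norm_mul_abs_sin_le _ _ _ _).2)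
    rw [norm_div, norm_pow, Complex.norm_natCast, Real.rpow_sub (hk2 k), Real.rpow_two]
    ring
  linarith

theorem isStrategicPair_iff {r s : ℝ} (hsr : s ≤ r) (t₀ t₁ : ℝ) :
    IsStrategicPair r s hsr (t₀, t₁) ↔ ∃ c : ℝ, 0 < c ∧ ∀ k : ℕ, 1 ≤ k →
        c * (k : ℝ) ^ (-(r - s)) ≤
          |(k : ℝ) ^ 2 * (t₀ - t₁) / Real.pi - round ((k : ℝ) ^ 2 * (t₀ - t₁) / Real.pi)| := by
  constructor
  · intro h
    obtain ⟨c, hc, H⟩ := h.exists_le_abs_sub_round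
    exact ⟨c, hc, fun k hk => H ⟨k, hk⟩⟩
  · rintro ⟨c, hc, H⟩
    exact isStrategicPair_of_le_abs_sub_round hsr hc fun k => H k k.pos

theorem isStrategicPair_of_sqBadlyApproximable {r s : ℝ} (hsr : s ≤ r) {p : ℝ × ℝ}
    (h : SqBadlyApproximable (r - s) ((p.1 - p.2) / Real.pi)) : IsStrategicPair r s hsr p := by
  obtain ⟨t₀, t₁⟩ := p
  rw [isStrategicPair_iff]
  simpa only [SqBadlyApproximable, mul_div_assoc] using h

end HingedBeam

theorem theorem6p3 (r s : ℝ) (hsr : s ≤ r) :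
    (∀ t₀ t₁ : ℝ, HingedBeam.IsStrategicPair r s hsr (t₀, t₁) ↔
      ∃ c : ℝ, 0 < c ∧ ∀ k : ℕ, 1 ≤ k →
        c * (k : ℝ) ^ (-(r - s)) ≤
          |(k : ℝ) ^ 2 * (t₀ - t₁) / Real.pi - round ((k : ℝ) ^ 2 * (t₀ - t₁) / Real.pi)|) ∧
    (r - s = 2 → ∃ S : Set (ℝ × ℝ), (∀ p ∈ S, HingedBeam.IsStrategicPair r s hsr p) ∧
      S.Infinite ∧ volume S = 0 ∧ dimH S = 2) ∧
    (2 < r - s → ∀ᵐ p : ℝ × ℝ ∂volume, HingedBeam.IsStrategicPair r s hsr p) := by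
  refine ⟨HingedBeam.isStrategicPair_iff hsr, fun h => ?_, fun h => ?_⟩
  -- Since `r - s = 2 > 1`, Borel–Cantelli already makes the admissible differences conull.
  · obtain ⟨S, hS, hvol, hdim⟩ := exists_null_dimH_eq_two Real.pi_ne_zero
      (ae_sqBadlyApproximable (τ := r - s) (by linarith))
    refine ⟨S, fun p hp => HingedBeam.isStrategicPair_of_sqBadlyApproximable hsr (hS p hp),
      fun hfin => ?_, hvol, hdim⟩
    rw [dimH_finite hfin] at hdim
    exact two_ne_zero hdim.symm
  · filter_upwards [ae_prod_sub_div Real.pi_ne_zero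
      (ae_sqBadlyApproximable (τ := r - s) (by linarith))] with p hp
    exact HingedBeam.isStrategicPair_of_sqBadlyApproximable hsr hp
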